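/- **QRF transformations between regular QRFs.** Let $G$ be a second-countable locally compact Hausdorff group that is unimodular (for instance any unimodular Lie group with countably many components), with a Haar measure $dg$, which is left-, right- and inversion-invariant. On $L^2(G)$ let $(L(g')\psi)(g)=\psi(g'^{-1}g)$ and $(R(g')\psi)(g)=\psi(gg')$ be the left- and right-regular representations, and let $\langle g|$ denote (improper) evaluation at $g$, so that $\langle\varphi|g\rangle\langle h|\psi\rangle=\overline{\varphi(g)}\,\psi(h)$. Let $A$ and $B$ be regular QRFs, that is $\mathcal H_A=\mathcal H_B=L^2(G)$ with $G$ acting by $L$, and let $\mathcal H_Q$ be a Hilbert space with a strongly continuous unitary representation $U_Q$ of $G$. Let $(U_r,\mathcal H_r)_{r\in\Lambda}$ be a measurable field of pairwise inequivalent irreducible unitary representations of $G$ over a $\sigma$-finite measure space $(\Lambda,\nu)$, let $C_r$ be a measurable field of complex conjugations (antiunitary involutions) of $\mathcal H_r$, and put $\mathcal H_{*,r}=\mathcal H_r$ and $U_{*,r}(g)=C_rU_r(g)C_r$, the complex conjugate representation. Write $\bigoplus_r$ for the direct integral over $(\Lambda,\nu)$ (the Hilbert direct sum if $\Lambda$ is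 countable and discrete with counting measure, as for compact $G$). A Peter–Weyl isomorphism is a unitary $X_A:L^2(G)\to\bigoplus_r\mathcal H_r\otimes\mathcal H_{*,r}$ with $X_AL(g)X_A^\dagger=\bigoplus_rU_r(g)\otimes\mathrm{id}_{*,r}$ and $X_AR(g)X_A^\dagger=\bigoplus_r\mathrm{id}_r\otimes U_{*,r}(g)$ for all $g\in G$. Let $X_A$ be one, and let $X_B$ be the same map on $\mathcal H_B$ (that is, $X_B|g\rangle_B=X_A|g\rangle_A$). All operator integrals below are understood weakly: their matrix elements between simple tensors are integrable and integrate to those of the operator. Then: 1. The jumps $$V^{\to A}=\int_G dg\;X_A|g\rangle\langle g|_A\otimes L_B^\dagger(g)\otimes U_Q^\dagger(g):\ \mathcal H_A\otimes\mathcal H_B\otimes\mathcal H_Q\to\Bigl(\bigoplus_r\mathcal H_r\otimes\mathcal H_{*,r}\Bigr)\otimes\mathcal H_B\otimes\mathcal H_Q,$$ $$V^{\to B}=\int_G dg\;L_A^\dagger(g)\otimes X_B|g\rangle\langle g|_B\otimes U_Q^\dagger(g):\ \mathcal H_A\otimes\mathcal H_B\otimes\mathcal H_Q\to\Bigl(\bigoplus_r\mathcal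 H_r\otimes\mathcal H_{*,r}\Bigr)\otimes\mathcal H_A\otimes\mathcal H_Q$$ exist as unique bounded operators and are unitary, and $V^{\to B}$ is $V^{\to A}$ with the labels $A$ and $B$ exchanged. 2. The QRF transformation $V^{A\to B}:=V^{\to B}(V^{\to A})^\dagger$ is $$V^{A\to B}=\int_G dg\;\Bigl(\bigoplus_r\mathrm{id}_r\otimes U_{*,r}^\dagger(g)\Bigr)\otimes|g^{-1}\rangle_A\langle g|_B\otimes U_Q^\dagger(g),$$ and this weak integral determines a unique bounded operator. 3. $V^{A\to B}$ does not depend on $X_A$ and $X_B$: any two Peter–Weyl isomorphisms onto the same space $\bigoplus_r\mathcal H_r\otimes\mathcal H_{*,r}$, intertwining with the same $U_r$ and $U_{*,r}$, give the same operator. -/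

import Mathlib

open MeasureTheory
open scoped TensorProduct InnerProduct ComplexConjugate

noncomputable section

namespace QRF

/-! ### Hilbert-space tensor products -/

/-- The Hilbert-space tensor product: the completion of the algebraic tensor product with its
canonical inner product. -/
abbrev HTensor (E F : Type*) [NormedAddCommGroup E] [InnerProductSpace ℂ E]
    [NormedAddCommGroup F] [InnerProductSpace ℂ F] : Type _ :=
  UniformSpace.Completion (E ⊗[ℂ] F)

/-- The simple tensor `x ⊗ y` in the Hilbert-space tensor product. -/
def tmul {E F : Type*} [NormedAddCommGroup E] [InnerProductSpace ℂ E]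
    [NormedAddCommGroup F] [InnerProductSpace ℂ F] (x : E) (y : F) : HTensor E F :=
  ((x ⊗ₜ[ℂ] y : E ⊗[ℂ] F) : UniformSpace.Completion (E ⊗[ℂ] F))

/-- The simple tensor `x ⊗ y ⊗ z`. -/
def tmul₃ {E F K : Type*} [NormedAddCommGroup E] [InnerProductSpace ℂ E]
    [NormedAddCommGroup F] [InnerProductSpace ℂ F]
    [NormedAddCommGroup K] [InnerProductSpace ℂ K] (x : E) (y : F) (z : K) :
    HTensor E (HTensor F K) :=
  tmul x (tmul y z)

/-- The operator `S ⊗ T`. -/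
def tensorOp {E F : Type*} [NormedAddCommGroup E] [InnerProductSpace ℂ E]
    [NormedAddCommGroup F] [InnerProductSpace ℂ F] (S : E →L[ℂ] E) (T : F →L[ℂ] F) :
    HTensor E F →L[ℂ] HTensor E F :=
  (TensorProduct.mapL S T).completion

theorem inner_tmul_tmul {E F : Type*} [NormedAddCommGroup E] [InnerProductSpace ℂ E]
    [NormedAddCommGroup F] [InnerProductSpace ℂ F] (x x' : E) (y y' : F) :
    inner ℂ (tmul x y) (tmul x' y') = inner ℂ x x' * inner ℂ y y' := by
  simp [tmul, UniformSpace.Completion.inner_coe, TensorProduct.inner_tmul]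

theorem tmul_zero' {E F : Type*} [NormedAddCommGroup E] [InnerProductSpace ℂ E]
    [NormedAddCommGroup F] [InnerProductSpace ℂ F] (x : E) : tmul x (0 : F) = 0 := by
  rw [tmul, TensorProduct.tmul_zero]; exact UniformSpace.Completion.coe_zero

theorem zero_tmul' {E F : Type*} [NormedAddCommGroup E] [InnerProductSpace ℂ E]
    [NormedAddCommGroup F] [InnerProductSpace ℂ F] (y : F) : tmul (0 : E) y = 0 := by
  rw [tmul, TensorProduct.zero_tmul]; exact UniformSpace.Completion.coe_zero

theorem tensorOp_tmul {E F : Type*} [NormedAddCommGroup E] [InnerProductSpace ℂ E]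
    [NormedAddCommGroup F] [InnerProductSpace ℂ F] (S : E →L[ℂ] E) (T : F →L[ℂ] F)
    (x : E) (y : F) : tensorOp S T (tmul x y) = tmul (S x) (T y) := by
  simp only [tensorOp, tmul, ContinuousLinearMap.completion_apply_coe]
  rfl

theorem inner_tmul_tensorOp {E F : Type*} [NormedAddCommGroup E] [InnerProductSpace ℂ E]
    [CompleteSpace E] [NormedAddCommGroup F] [InnerProductSpace ℂ F] [CompleteSpace F]
    (S : E →L[ℂ] E) (T : F →L[ℂ] F) (x : E) (y : F) (z : HTensor E F) :
    inner ℂ (tmul x y) (tensorOp S T z) = inner ℂ (tmul ((S†) x) ((T†) y)) z := by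
  induction z using UniformSpace.Completion.induction_on with
  | hp => exact isClosed_eq (by fun_prop) (by fun_prop)
  | ih z =>
    induction z using TensorProduct.induction_on with
    | zero =>
      rw [UniformSpace.Completion.coe_zero, map_zero, inner_zero_right, inner_zero_right]
    | tmul a b =>
      change inner ℂ (tmul x y) (tensorOp S T (tmul a b)) = inner ℂ (tmul _ _) (tmul a b)
      rw [tensorOp_tmul, inner_tmul_tmul, inner_tmul_tmul,
        ContinuousLinearMap.adjoint_inner_left, ContinuousLinearMap.adjoint_inner_left]
    | add a b ha hb =>
      rw [UniformSpace.Completion.coe_add, map_add, inner_add_right, inner_add_right, ha, hb]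

theorem norm_tensorOp_le_one {E F : Type*} [NormedAddCommGroup E] [InnerProductSpace ℂ E]
    [NormedAddCommGroup F] [InnerProductSpace ℂ F] {S : E →L[ℂ] E} {T : F →L[ℂ] F}
    (hS : ‖S‖ ≤ 1) (hT : ‖T‖ ≤ 1) : ‖tensorOp S T‖ ≤ 1 := by
  have h1 : ‖TensorProduct.mapL S T‖ ≤ 1 :=
    (TensorProduct.norm_mapL_le S T).trans (mul_le_one₀ hS (norm_nonneg _) hT)
  refine ContinuousLinearMap.opNorm_le_bound _ zero_le_one fun z => ?_
  induction z using UniformSpace.Completion.induction_on with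
  | hp => exact isClosed_le (by fun_prop) (by fun_prop)
  | ih z =>
    rw [tensorOp, ContinuousLinearMap.completion_apply_coe, UniformSpace.Completion.norm_coe,
      UniformSpace.Completion.norm_coe]
    exact (TensorProduct.mapL S T).le_of_opNorm_le h1 z

/-! ### Unitary representations -/

/-- A strongly continuous unitary representation of `G` on `E`. -/
structure UnitaryRep (G E : Type*) [Group G] [TopologicalSpace G] [NormedAddCommGroup E]
    [InnerProductSpace ℂ E] where
  toHom : G →* (E ≃ₗᵢ[ℂ] E)
  continuous_apply : ∀ v : E, Continuous fun g => toHom g v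

namespace UnitaryRep

variable {G E F : Type*} [Group G] [TopologicalSpace G] [NormedAddCommGroup E]
  [InnerProductSpace ℂ E] [NormedAddCommGroup F] [InnerProductSpace ℂ F]

/-- The unitary operator `U(g)`, as a bounded operator. -/
def op (U : UnitaryRep G E) (g : G) : E →L[ℂ] E :=
  (U.toHom g).toLinearIsometry.toContinuousLinearMap

/-- Irreducibility: the space is nonzero and has no closed invariant subspaces but the
trivial ones. -/
def IsIrreducible (U : UnitaryRep G E) : Prop :=
  Nontrivial E ∧ ∀ W : Submodule ℂ E, IsClosed (W : Set E) →
    (∀ g, ∀ v ∈ W, U.op g v ∈ W) → W = ⊥ ∨ W = ⊤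

/-- Unitary equivalence of representations. -/
def Equivalent (U : UnitaryRep G E) (V : UnitaryRep G F) : Prop :=
  ∃ T : E ≃ₗᵢ[ℂ] F, ∀ g v, T (U.op g v) = V.op g (T v)

/-- The complex conjugate representation `C U(g) C⁻¹` on the same space, with respect to a
conjugation `C`. -/
def conjRep (U : UnitaryRep G E) (C : E ≃ₗᵢ⋆[ℂ] E) : UnitaryRep G E where
  toHom :=
    { toFun := fun g => (C.symm.trans (U.toHom g)).trans C
      map_one' := by ext v; simp
      map_mul' := fun g h => by ext v; simp }
  continuous_apply := fun v => C.continuous.comp (U.continuous_apply (C.symm v))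

theorem conjRep_op_apply (U : UnitaryRep G E) (C : E ≃ₗᵢ⋆[ℂ] E) (g : G) (v : E) :
    (U.conjRep C).op g v = C (U.op g (C.symm v)) := rfl

theorem norm_op_apply (U : UnitaryRep G E) (g : G) (v : E) : ‖U.op g v‖ = ‖v‖ :=
  (U.toHom g).norm_map v

theorem inner_op_right (U : UnitaryRep G E) (g : G) (v w : E) :
    inner ℂ v (U.op g w) = inner ℂ (U.op g⁻¹ v) w := by
  have h : v = U.op g (U.op g⁻¹ v) := by
    change v = (U.toHom g * U.toHom g⁻¹) v
    rw [← map_mul]; simp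
  conv_lhs => rw [h]
  exact (U.toHom g).inner_map_map _ _

theorem adjoint_op [CompleteSpace E] (U : UnitaryRep G E) (g : G) :
    (U.op g)† = U.op g⁻¹ := by
  symm
  rw [ContinuousLinearMap.eq_adjoint_iff]
  intro v w
  rw [U.inner_op_right]

theorem norm_op_le (U : UnitaryRep G E) (g : G) : ‖U.op g‖ ≤ 1 :=
  (U.op g).opNorm_le_bound zero_le_one fun v => by rw [U.norm_op_apply, one_mul]

end UnitaryRep

/-! ### Measurable fields of Hilbert spaces and their direct integrals -/

section DirectIntegral

variable {Λ : Type*} [MeasurableSpace Λ] {H : Λ → Type*}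
  [∀ r, NormedAddCommGroup (H r)] [∀ r, InnerProductSpace ℂ (H r)]

/-- A measurable field of Hilbert spaces: a fundamental sequence of sections with measurable
mutual inner products, total in every fibre. -/
structure MeasurableField (H : Λ → Type*)
    [∀ r, NormedAddCommGroup (H r)] [∀ r, InnerProductSpace ℂ (H r)] where
  fund : ℕ → ∀ r, H r
  measurable_inner_fund : ∀ m n, Measurable fun r => inner ℂ (fund m r) (fund n r)
  dense_span : ∀ r, Dense (Submodule.span ℂ (Set.range fun n => fund n r) : Set (H r))

namespace MeasurableField

/-- Measurable sections of a measurable field. -/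
def IsSection (F : MeasurableField H) (ψ : ∀ r, H r) : Prop :=
  ∀ n, Measurable fun r => inner ℂ (F.fund n r) (ψ r)

theorem isSection_fund (F : MeasurableField H) (n : ℕ) : F.IsSection (F.fund n) :=
  fun m => F.measurable_inner_fund m n

theorem IsSection.add {F : MeasurableField H} {ψ φ : ∀ r, H r} (hψ : F.IsSection ψ)
    (hφ : F.IsSection φ) : F.IsSection (ψ + φ) := fun n => by
  simp only [Pi.add_apply, inner_add_right]
  exact (hψ n).add (hφ n)

theorem IsSection.smul {F : MeasurableField H} {ψ : ∀ r, H r} (c : ℂ) (hψ : F.IsSection ψ) :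
    F.IsSection (c • ψ) := fun n => by
  simpa [inner_smul_right] using (hψ n).const_mul c

theorem isSection_zero (F : MeasurableField H) : F.IsSection 0 := fun n => by simp

/-- Finite combinations of the fundamental sequence with coefficients in a countable dense
set. -/
def comb (F : MeasurableField H) (l : List (ℕ × ℕ)) (r : Λ) : H r :=
  (l.map fun p => TopologicalSpace.denseSeq ℂ p.1 • F.fund p.2 r).sum

theorem measurable_inner_comb (F : MeasurableField H) (l : List (ℕ × ℕ))
    {ψ : ∀ r, H r} (hψ : F.IsSection ψ) :
    Measurable fun r => inner ℂ (F.comb l r) (ψ r) := by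
  induction l with
  | nil => simp [comb]
  | cons p l ih =>
    simp only [comb, List.map_cons, List.sum_cons, inner_add_left, inner_smul_left]
    exact ((hψ p.2).const_mul _).add ih

theorem isSection_comb (F : MeasurableField H) (l : List (ℕ × ℕ)) :
    F.IsSection (F.comb l) := fun n => by
  have h := F.measurable_inner_comb l (F.isSection_fund n)
  have h2 := (Complex.continuous_conj.measurable).comp h
  simpa [Function.comp_def, inner_conj_symm] using h2

theorem dense_comb (F : MeasurableField H) (r : Λ) :
    Dense (Set.range fun l => F.comb l r) := by
  let A : AddSubmonoid (H r) :=
    { carrier := Set.range fun l => F.comb l r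
      zero_mem' := ⟨[], by simp [comb]⟩
      add_mem' := by
        rintro _ _ ⟨l, rfl⟩ ⟨l', rfl⟩
        exact ⟨l ++ l', by simp [comb]⟩ }
  have hs : ∀ (c : ℂ) (n : ℕ), c • F.fund n r ∈ A.topologicalClosure := by
    intro c n
    have hc : Continuous fun c : ℂ => c • F.fund n r := by fun_prop
    have := hc.range_subset_closure_image_dense (TopologicalSpace.denseRange_denseSeq ℂ)
      (Set.mem_range_self c)
    refine closure_mono ?_ this
    rintro _ ⟨_, ⟨i, rfl⟩, rfl⟩
    exact ⟨[(i, n)], by simp [comb]⟩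
  have hsub : (Submodule.span ℂ (Set.range fun n => F.fund n r) : Set (H r)) ⊆
      A.topologicalClosure := by
    intro x hx
    obtain ⟨c, rfl⟩ := Finsupp.mem_span_range_iff_exists_finsupp.1 hx
    exact AddSubmonoid.sum_mem _ fun n _ => hs _ _
  have : Dense (A.topologicalClosure : Set (H r)) := (F.dense_span r).mono hsub
  exact dense_closure.1 this

theorem IsSection.measurable_norm {F : MeasurableField H} {ψ : ∀ r, H r}
    (hψ : F.IsSection ψ) : Measurable fun r => ‖ψ r‖ := by
  have hn : ∀ l, Measurable fun r => ‖F.comb l r‖ := fun l => by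
    have h := F.measurable_inner_comb l (F.isSection_comb l)
    simp only [norm_eq_sqrt_re_inner (𝕜 := ℂ)]
    exact (Complex.measurable_re.comp h).sqrt
  refine measurable_of_Iic fun t => ?_
  rcases lt_or_ge t 0 with ht | ht
  · convert MeasurableSet.empty
    ext r
    simpa using ht.trans_le (norm_nonneg _)
  have : (fun r => ‖ψ r‖) ⁻¹' Set.Iic t =
      ⋂ l : List (ℕ × ℕ), {r | ‖inner ℂ (F.comb l r) (ψ r)‖ ≤ t * ‖F.comb l r‖} := by
    ext r
    simp only [Set.mem_preimage, Set.mem_Iic, Set.mem_iInter, Set.mem_ofPred_eq]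
    constructor
    · intro h l
      refine (norm_inner_le_norm _ _).trans ?_
      rw [mul_comm]
      gcongr
    · intro h
      have hall : ∀ x : H r, ‖inner ℂ x (ψ r)‖ ≤ t * ‖x‖ := by
        have hcl : IsClosed {x : H r | ‖inner ℂ x (ψ r)‖ ≤ t * ‖x‖} :=
          isClosed_le (by fun_prop) (by fun_prop)
        intro x
        have hx := (F.dense_comb r) x
        refine closure_minimal ?_ hcl hx
        rintro _ ⟨l, rfl⟩
        exact h l
      have h2 := hall (ψ r)
      rw [inner_self_eq_norm_sq_to_K] at h2
      rcases (norm_nonneg (ψ r)).eq_or_lt with h0 | h0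
      · rw [← h0]; exact ht
      · simp only [norm_pow, Complex.coe_algebraMap, Complex.norm_real, norm_norm] at h2
        nlinarith
  rw [this]
  exact MeasurableSet.iInter fun l => measurableSet_le
    (F.measurable_inner_comb l hψ).norm ((hn l).const_mul t)

theorem IsSection.measurable_inner {F : MeasurableField H} {ψ φ : ∀ r, H r}
    (hψ : F.IsSection ψ) (hφ : F.IsSection φ) :
    Measurable fun r => inner ℂ (ψ r) (φ r) := by
  have key : ∀ c : ℂ, Measurable fun r => ‖ψ r + c • φ r‖ := fun c =>
    (hψ.add (hφ.smul c)).measurable_norm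
  have h1 := key 1
  have h2 := key (-1)
  have h3 := key Complex.I
  have h4 := key (-Complex.I)
  simp only [one_smul, neg_smul, ← sub_eq_add_neg] at h1 h2 h3 h4
  simp only [inner_eq_sum_norm_sq_div_four (𝕜 := ℂ), RCLike.I_to_complex]
  fun_prop

/-- The measurable field `r ↦ H r ⊗ K r`. -/
def tensor {K : Λ → Type*} [∀ r, NormedAddCommGroup (K r)] [∀ r, InnerProductSpace ℂ (K r)]
    (F : MeasurableField H) (F' : MeasurableField K) :
    MeasurableField fun r => HTensor (H r) (K r) where
  fund := fun n r => tmul (F.fund n.unpair.1 r) (F'.fund n.unpair.2 r)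
  measurable_inner_fund := fun m n => by
    simp only [inner_tmul_tmul]
    exact (F.measurable_inner_fund _ _).mul (F'.measurable_inner_fund _ _)
  dense_span := fun r => by
    set S := (Submodule.span ℂ (Set.range fun n : ℕ =>
      tmul (F.fund n.unpair.1 r) (F'.fund n.unpair.2 r))).topologicalClosure with hS
    have hcont : Continuous fun p : H r × K r => tmul p.1 p.2 := by
      have : Continuous fun p : H r × K r => TensorProduct.mkL ℂ (H r) (K r) p.1 p.2 := by
        fun_prop
      exact (UniformSpace.Completion.continuous_coe _).comp this
    have h1 : ∀ x ∈ Submodule.span ℂ (Set.range fun n => F.fund n r),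
        ∀ y ∈ Submodule.span ℂ (Set.range fun n => F'.fund n r), tmul x y ∈ S := by
      intro x hx y hy
      induction hx using Submodule.span_induction with
      | mem x hx =>
        obtain ⟨i, rfl⟩ := hx
        induction hy using Submodule.span_induction with
        | mem y hy =>
          obtain ⟨j, rfl⟩ := hy
          refine Submodule.le_topologicalClosure _ (Submodule.subset_span ⟨Nat.pair i j, ?_⟩)
          simp
        | zero => rw [tmul_zero']; exact S.zero_mem
        | add y z _ _ hy hz =>
          simp only [tmul, TensorProduct.tmul_add, UniformSpace.Completion.coe_add]
          exact S.add_mem hy hz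
        | smul c y _ hy => simpa [tmul] using S.smul_mem c hy
      | zero => rw [zero_tmul']; exact S.zero_mem
      | add y z _ _ hy hz =>
        simp only [tmul, TensorProduct.add_tmul, UniformSpace.Completion.coe_add]
        exact S.add_mem hy hz
      | smul c y _ hy =>
        have := S.smul_mem c hy
        simpa only [tmul, ← UniformSpace.Completion.coe_smul, TensorProduct.smul_tmul'] using this
    have hcl : IsClosed (S : Set (HTensor (H r) (K r))) :=
      Submodule.isClosed_topologicalClosure _
    have h2 : ∀ p : H r × K r, tmul p.1 p.2 ∈ S := by
      intro p
      have hd := (F.dense_span r).prod (F'.dense_span r)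
      refine closure_minimal (s := _ ×ˢ _) ?_ (hcl.preimage hcont) (hd p)
      rintro ⟨x, y⟩ ⟨hx, hy⟩
      exact h1 x hx y hy
    have h3 : ∀ z : H r ⊗[ℂ] K r, (z : HTensor (H r) (K r)) ∈ S := by
      intro z
      induction z using TensorProduct.induction_on with
      | zero => rw [UniformSpace.Completion.coe_zero]; exact S.zero_mem
      | tmul x y => exact h2 (x, y)
      | add x y hx hy => rw [UniformSpace.Completion.coe_add]; exact S.add_mem hx hy
    have h4 : Dense (S : Set (HTensor (H r) (K r))) := by
      refine UniformSpace.Completion.denseRange_coe.mono ?_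
      rintro _ ⟨z, rfl⟩
      exact h3 z
    rw [hS, Submodule.topologicalClosure_coe] at h4
    exact dense_closure.1 h4

theorem IsSection.tmul {K : Λ → Type*} [∀ r, NormedAddCommGroup (K r)]
    [∀ r, InnerProductSpace ℂ (K r)] {F : MeasurableField H} {F' : MeasurableField K}
    {ψ : ∀ r, H r} {φ : ∀ r, K r} (hψ : F.IsSection ψ) (hφ : F'.IsSection φ) :
    (F.tensor F').IsSection fun r => QRF.tmul (ψ r) (φ r) := fun n => by
  simp only [tensor, inner_tmul_tmul]
  exact (hψ _).mul (hφ _)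

/-- The square-integrable measurable sections. -/
def sqIntSubmodule (F : MeasurableField H) (ν : Measure Λ) : Submodule ℂ (∀ r, H r) where
  carrier := {ψ | F.IsSection ψ ∧ MemLp (fun r => ‖ψ r‖) 2 ν}
  zero_mem' := ⟨F.isSection_zero, by simp⟩
  add_mem' := by
    rintro ψ φ ⟨hψ, hψ'⟩ ⟨hφ, hφ'⟩
    refine ⟨hψ.add hφ, (hψ'.add hφ').mono (hψ.add hφ).measurable_norm.aestronglyMeasurable ?_⟩
    refine Filter.Eventually.of_forall fun r => ?_
    simp only [Pi.add_apply, Real.norm_eq_abs, abs_norm]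
    exact (norm_add_le (ψ r) (φ r)).trans (le_abs_self _)
  smul_mem' := by
    rintro c ψ ⟨hψ, hψ'⟩
    refine ⟨hψ.smul c, ?_⟩
    simpa [norm_smul] using hψ'.const_mul ‖c‖

/-- The space of square-integrable measurable sections (a semi-inner-product space, not yet
taken modulo equality almost everywhere). -/
def SqInt (F : MeasurableField H) (ν : Measure Λ) : Type _ := F.sqIntSubmodule ν

instance (F : MeasurableField H) (ν : Measure Λ) : AddCommGroup (F.SqInt ν) :=
  inferInstanceAs (AddCommGroup (F.sqIntSubmodule ν))

instance (F : MeasurableField H) (ν : Measure Λ) : Module ℂ (F.SqInt ν) :=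
  inferInstanceAs (Module ℂ (F.sqIntSubmodule ν))

theorem integrable_inner (F : MeasurableField H) (ν : Measure Λ) (ψ φ : F.SqInt ν) :
    Integrable (fun r => inner ℂ (ψ.1 r) (φ.1 r)) ν := by
  refine Integrable.mono' (ψ.2.2.integrable_mul φ.2.2)
    (ψ.2.1.measurable_inner φ.2.1).aestronglyMeasurable ?_
  exact Filter.Eventually.of_forall fun r => norm_inner_le_norm _ _

/-- The semi-inner product `∫ ⟨ψ(r), φ(r)⟩ dν(r)`. -/
instance preCore (F : MeasurableField H) (ν : Measure Λ) :
    PreInnerProductSpace.Core ℂ (F.SqInt ν) where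
  inner ψ φ := ∫ r, inner ℂ (ψ.1 r) (φ.1 r) ∂ν
  conj_inner_symm ψ φ := by
    rw [← integral_conj]
    exact integral_congr_ae (Filter.Eventually.of_forall fun r => inner_conj_symm _ _)
  re_inner_nonneg ψ := by
    have h : RCLike.re (∫ r, inner ℂ (ψ.1 r) (ψ.1 r) ∂ν) =
        ∫ r, RCLike.re (inner ℂ (ψ.1 r) (ψ.1 r)) ∂ν :=
      (integral_re (F.integrable_inner ν ψ ψ)).symm
    rw [h]
    exact integral_nonneg fun r => inner_self_nonneg
  add_left ψ φ χ := by
    rw [← integral_add (F.integrable_inner ν ψ χ) (F.integrable_inner ν φ χ)]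
    exact integral_congr_ae (Filter.Eventually.of_forall fun r => inner_add_left _ _ _)
  smul_left ψ φ c := by
    rw [← integral_const_mul]
    exact integral_congr_ae (Filter.Eventually.of_forall fun r => inner_smul_left _ _ _)

instance (F : MeasurableField H) (ν : Measure Λ) : SeminormedAddCommGroup (F.SqInt ν) :=
  InnerProductSpace.Core.toSeminormedAddCommGroup (𝕜 := ℂ)

instance (F : MeasurableField H) (ν : Measure Λ) : InnerProductSpace ℂ (F.SqInt ν) :=
  .ofCore _

theorem inner_sqInt (F : MeasurableField H) (ν : Measure Λ) (ψ φ : F.SqInt ν) :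
    inner ℂ ψ φ = ∫ r, inner ℂ (ψ.1 r) (φ.1 r) ∂ν := rfl

/-- The direct integral `∫⊕ H r dν(r)`: square-integrable measurable sections modulo equality
almost everywhere. The semi-inner-product space `SqInt` is complete when the fibres are, so
that passing to the Hausdorff completion only identifies sections that agree almost
everywhere. For the counting measure on a countable discrete `Λ` this is the Hilbert-space
direct sum of the `H r`. -/
abbrev DirectIntegral (F : MeasurableField H) (ν : Measure Λ) : Type _ :=
  UniformSpace.Completion (F.SqInt ν)

/-- A field of operators `T r` with norms at most one that preserves measurability of sections,
acting on square-integrable sections. -/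
def decompSqInt (F : MeasurableField H) (ν : Measure Λ) (T : ∀ r, H r →L[ℂ] H r)
    (hT : ∀ r, ‖T r‖ ≤ 1) (hm : ∀ ψ, F.IsSection ψ → F.IsSection fun r => T r (ψ r)) :
    F.SqInt ν →L[ℂ] F.SqInt ν :=
  have hle : ∀ (ψ : ∀ r, H r) (r : Λ), ‖T r (ψ r)‖ ≤ ‖ψ r‖ := fun ψ r =>
    (T r).le_of_opNorm_le_of_le (hT r) le_rfl |>.trans (one_mul _).le
  LinearMap.mkContinuous
    { toFun := fun ψ => ⟨fun r => T r (ψ.1 r), hm _ ψ.2.1,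
        ψ.2.2.mono (hm _ ψ.2.1).measurable_norm.aestronglyMeasurable
          (Filter.Eventually.of_forall fun r => by simpa using hle ψ.1 r)⟩
      map_add' := fun ψ φ => Subtype.ext (funext fun r => map_add (T r) (ψ.1 r) (φ.1 r))
      map_smul' := fun c ψ => Subtype.ext (funext fun r => map_smul (T r) c (ψ.1 r)) } 1
    (fun ψ => by
      rw [one_mul]
      refine Real.sqrt_le_sqrt ?_
      change RCLike.re (∫ r, inner ℂ (T r (ψ.1 r)) (T r (ψ.1 r)) ∂ν) ≤
        RCLike.re (∫ r, inner ℂ (ψ.1 r) (ψ.1 r) ∂ν)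
      have hφ : Integrable (fun r => inner ℂ (T r (ψ.1 r)) (T r (ψ.1 r))) ν := by
        refine (F.integrable_inner ν ψ ψ).mono
          ((hm _ ψ.2.1).measurable_inner (hm _ ψ.2.1)).aestronglyMeasurable
          (Filter.Eventually.of_forall fun r => ?_)
        simp only [inner_self_eq_norm_sq_to_K, norm_pow, Complex.coe_algebraMap,
          Complex.norm_real, norm_norm]
        gcongr
        exact hle ψ.1 r
      rw [← integral_re hφ, ← integral_re (F.integrable_inner ν ψ ψ)]
      refine integral_mono hφ.re (F.integrable_inner ν ψ ψ).re fun r => ?_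
      simp only [inner_self_eq_norm_sq]
      gcongr
      exact hle ψ.1 r)

/-- The decomposable operator `∫⊕ T r dν(r)`, written `⊕ᵣ T r` in the discrete case. -/
def decomp (F : MeasurableField H) (ν : Measure Λ) (T : ∀ r, H r →L[ℂ] H r)
    (hT : ∀ r, ‖T r‖ ≤ 1) (hm : ∀ ψ, F.IsSection ψ → F.IsSection fun r => T r (ψ r)) :
    F.DirectIntegral ν →L[ℂ] F.DirectIntegral ν :=
  (F.decompSqInt ν T hT hm).completion

/-- The operator `∫⊕ S r ⊗ T r dν(r)`, written `⊕ᵣ S r ⊗ T r` in the discrete case, for fields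
of operators with norms at most one that preserve measurability of sections. -/
def decompTensor [∀ r, CompleteSpace (H r)] {K : Λ → Type*} [∀ r, NormedAddCommGroup (K r)]
    [∀ r, InnerProductSpace ℂ (K r)] [∀ r, CompleteSpace (K r)]
    (F : MeasurableField H) (F' : MeasurableField K) (ν : Measure Λ)
    (S : ∀ r, H r →L[ℂ] H r) (T : ∀ r, K r →L[ℂ] K r)
    (hS : ∀ r, ‖S r‖ ≤ 1) (hT : ∀ r, ‖T r‖ ≤ 1)
    (hmS : ∀ ψ, F.IsSection ψ → F.IsSection fun r => S r (ψ r))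
    (hmT : ∀ ψ, F'.IsSection ψ → F'.IsSection fun r => T r (ψ r)) :
    (F.tensor F').DirectIntegral ν →L[ℂ] (F.tensor F').DirectIntegral ν :=
  (F.tensor F').decomp ν (fun r => tensorOp (S r) (T r))
    (fun r => norm_tensorOp_le_one (hS r) (hT r))
    (fun ψ hψ n => by
      have h1 : F.IsSection fun r => ((S r)†) (F.fund n.unpair.1 r) := fun m => by
        simp only [ContinuousLinearMap.adjoint_inner_right]
        exact (hmS _ (F.isSection_fund m)).measurable_inner (F.isSection_fund _)
      have h2 : F'.IsSection fun r => ((T r)†) (F'.fund n.unpair.2 r) := fun m => by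
        simp only [ContinuousLinearMap.adjoint_inner_right]
        exact (hmT _ (F'.isSection_fund m)).measurable_inner (F'.isSection_fund _)
      change Measurable fun r => inner ℂ
        (QRF.tmul (F.fund n.unpair.1 r) (F'.fund n.unpair.2 r)) (tensorOp (S r) (T r) (ψ r))
      simp only [inner_tmul_tensorOp]
      exact (h1.tmul h2).measurable_inner hψ)

end MeasurableField

end DirectIntegral

/-! ### Fields of irreducible representations -/

section Irreps

variable {G : Type*} [Group G] [TopologicalSpace G] {Λ : Type*} [MeasurableSpace Λ]
  {H : Λ → Type*} [∀ r, NormedAddCommGroup (H r)] [∀ r, InnerProductSpace ℂ (H r)]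

/-- A measurable field of pairwise inequivalent irreducible unitary representations `U r` of
`G` on Hilbert spaces `H r`, together with a measurable field of complex conjugations `C r`.
The multiplicity space is `H r` itself, carrying the complex conjugate representation. -/
structure IrrepField (G : Type*) [Group G] [TopologicalSpace G] (H : Λ → Type*)
    [∀ r, NormedAddCommGroup (H r)] [∀ r, InnerProductSpace ℂ (H r)] where
  field : MeasurableField H
  U : ∀ r, UnitaryRep G (H r)
  U_section : ∀ g ψ, field.IsSection ψ → field.IsSection fun r => (U r).op g (ψ r)
  C : ∀ r, H r ≃ₗᵢ⋆[ℂ] H r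
  C_involutive : ∀ r, Function.Involutive (C r)
  C_section : ∀ ψ, field.IsSection ψ → field.IsSection fun r => C r (ψ r)
  irreducible : ∀ r, (U r).IsIrreducible
  inequivalent : ∀ r s, r ≠ s → ¬ (U r).Equivalent (U s)

namespace IrrepField

/-- The complex conjugate representation on the multiplicity space. -/
def Ustar (D : IrrepField G H) (r : Λ) : UnitaryRep G (H r) := (D.U r).conjRep (D.C r)

theorem Ustar_section (D : IrrepField G H) (g : G) (ψ : ∀ r, H r) (hψ : D.field.IsSection ψ) :
    D.field.IsSection fun r => (D.Ustar r).op g (ψ r) := by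
  have h : ∀ r, (D.C r).symm (ψ r) = D.C r (ψ r) := fun r => by
    rw [LinearIsometryEquiv.symm_apply_eq, D.C_involutive r]
  simp only [Ustar, UnitaryRep.conjRep_op_apply, h]
  exact D.C_section _ (D.U_section g _ (D.C_section _ hψ))

variable [∀ r, CompleteSpace (H r)]

/-- The Hilbert space `⊕ᵣ H r ⊗ H r` (a direct integral in general), the second factor being
the multiplicity space. -/
abbrev Space (D : IrrepField G H) (ν : Measure Λ) : Type _ :=
  (D.field.tensor D.field).DirectIntegral ν

/-- `⊕ᵣ U r (g) ⊗ id`. -/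
def leftOp (D : IrrepField G H) (ν : Measure Λ) (g : G) : D.Space ν →L[ℂ] D.Space ν :=
  D.field.decompTensor D.field ν (fun r => (D.U r).op g) (fun _ => .id ℂ _)
    (fun r => (D.U r).norm_op_le g) (fun _ => ContinuousLinearMap.norm_id_le)
    (D.U_section g) (fun _ h => h)

/-- `⊕ᵣ id ⊗ Ustar r (g)`. -/
def rightOp (D : IrrepField G H) (ν : Measure Λ) (g : G) : D.Space ν →L[ℂ] D.Space ν :=
  D.field.decompTensor D.field ν (fun _ => .id ℂ _) (fun r => (D.Ustar r).op g)
    (fun _ => ContinuousLinearMap.norm_id_le) (fun r => (D.Ustar r).norm_op_le g)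
    (fun _ h => h) (D.Ustar_section g)

/-- `⊕ᵣ id ⊗ (Ustar r (g))†`. -/
def rightOpAdj (D : IrrepField G H) (ν : Measure Λ) (g : G) : D.Space ν →L[ℂ] D.Space ν :=
  D.field.decompTensor D.field ν (fun _ => .id ℂ _) (fun r => ((D.Ustar r).op g)†)
    (fun _ => ContinuousLinearMap.norm_id_le)
    (fun r => by rw [UnitaryRep.adjoint_op]; exact (D.Ustar r).norm_op_le _)
    (fun _ h => h)
    (fun ψ hψ => by simp only [UnitaryRep.adjoint_op]; exact D.Ustar_section _ ψ hψ)

end IrrepField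

end Irreps

/-! ### Regular representations and the Peter–Weyl isomorphism -/

section Regular

variable {G : Type*} [Group G] [TopologicalSpace G] [IsTopologicalGroup G]
  [SecondCountableTopology G] [MeasurableSpace G] [BorelSpace G] (μ : Measure G)

/-- The Hilbert space `L²(G)` of a regular quantum reference frame. -/
abbrev L2 : Type _ := Lp ℂ 2 μ

/-- The left-regular representation, `(L(g')ψ)(g) = ψ(g'⁻¹ g)`. -/
def leftReg [μ.IsMulLeftInvariant] (g' : G) : L2 μ →L[ℂ] L2 μ :=
  (Lp.compMeasurePreservingₗᵢ ℂ (fun g => g'⁻¹ * g)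
    (measurePreserving_mul_left μ g'⁻¹)).toContinuousLinearMap

/-- The right-regular representation, `(R(g')ψ)(g) = ψ(g g')`. -/
def rightReg [μ.IsMulRightInvariant] (g' : G) : L2 μ →L[ℂ] L2 μ :=
  (Lp.compMeasurePreservingₗᵢ ℂ (fun g => g * g')
    (measurePreserving_mul_right μ g')).toContinuousLinearMap

/-- The improper matrix element `⟨φ|g⟩⟨h|ψ⟩` on `L²(G)`. -/
def ketBra {μ : Measure G} (g h : G) (φ ψ : L2 μ) : ℂ := conj (φ g) * ψ h

variable {Λ : Type*} [MeasurableSpace Λ]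
  {H : Λ → Type*} [∀ r, NormedAddCommGroup (H r)] [∀ r, InnerProductSpace ℂ (H r)]
  [∀ r, CompleteSpace (H r)]

/-- A Peter–Weyl isomorphism `X : L²(G) → ⊕ᵣ H r ⊗ H r`: a unitary which turns the left-regular
representation into `⊕ᵣ U r ⊗ id` and the right-regular one into `⊕ᵣ id ⊗ Ustar r`. -/
structure PeterWeylIso [μ.IsMulLeftInvariant] [μ.IsMulRightInvariant]
    (D : IrrepField G H) (ν : Measure Λ) where
  X : L2 μ ≃ₗᵢ[ℂ] D.Space ν
  map_left : ∀ g φ, X (leftReg μ g φ) = D.leftOp ν g (X φ)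
  map_right : ∀ g φ, X (rightReg μ g φ) = D.rightOp ν g (X φ)

/-! ### Improper integrals, jumps, and transformations -/

/-- `T = ∫ O(g) dμ(g)` in the weak sense, for operators between triple tensor products:
`m g x y` is the matrix element of the (possibly improper) operator `O(g)` between the simple
tensors `x = x₁ ⊗ x₂ ⊗ x₃` and `y = y₁ ⊗ y₂ ⊗ y₃`; all these matrix elements are integrable,
and integrate to those of `T`. -/
def IsWeakIntegral {E₁ E₂ E₃ F₁ F₂ F₃ : Type*}
    [NormedAddCommGroup E₁] [InnerProductSpace ℂ E₁]
    [NormedAddCommGroup E₂] [InnerProductSpace ℂ E₂]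
    [NormedAddCommGroup E₃] [InnerProductSpace ℂ E₃]
    [NormedAddCommGroup F₁] [InnerProductSpace ℂ F₁]
    [NormedAddCommGroup F₂] [InnerProductSpace ℂ F₂]
    [NormedAddCommGroup F₃] [InnerProductSpace ℂ F₃]
    (m : G → F₁ × F₂ × F₃ → E₁ × E₂ × E₃ → ℂ)
    (T : HTensor E₁ (HTensor E₂ E₃) →L[ℂ] HTensor F₁ (HTensor F₂ F₃)) : Prop :=
  ∀ (x : F₁ × F₂ × F₃) (y : E₁ × E₂ × E₃),
    Integrable (fun g => m g x y) μ ∧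
      inner ℂ (tmul₃ x.1 x.2.1 x.2.2) (T (tmul₃ y.1 y.2.1 y.2.2)) = ∫ g, m g x y ∂μ

variable {HQ : Type*} [NormedAddCommGroup HQ] [InnerProductSpace ℂ HQ] [CompleteSpace HQ]

variable {μ} in
/-- `V = ∫ X_A|g⟩⟨g|_A ⊗ L_B(g)† ⊗ U_Q(g)† dg` from `A ⊗ B ⊗ Q` to `(⊕ᵣ H r ⊗ H r) ⊗ B ⊗ Q`:
the jump into the perspective of `A`. -/
def IsJumpA [μ.IsMulLeftInvariant] [μ.IsMulRightInvariant] {D : IrrepField G H}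
    {ν : Measure Λ} (W : PeterWeylIso μ D ν) (UQ : UnitaryRep G HQ)
    (V : HTensor (L2 μ) (HTensor (L2 μ) HQ) →L[ℂ]
      HTensor (D.Space ν) (HTensor (L2 μ) HQ)) : Prop :=
  IsWeakIntegral μ (fun g (ξ, b, q) (a', b', q') =>
    ketBra g g (W.X.symm ξ) a' * inner ℂ b (((leftReg μ g)†) b') *
      inner ℂ q (((UQ.op g)†) q')) V

variable {μ} in
/-- `V = ∫ L_A(g)† ⊗ X_B|g⟩⟨g|_B ⊗ U_Q(g)† dg` from `A ⊗ B ⊗ Q` to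
`(⊕ᵣ H r ⊗ H r) ⊗ A ⊗ Q`: the jump into the perspective of `B`. The factor `X_B|g⟩⟨g|_B`
maps the second factor of the domain to the first factor of the codomain; `X_B` is `X_A`
with the label changed. -/
def IsJumpB [μ.IsMulLeftInvariant] [μ.IsMulRightInvariant] {D : IrrepField G H}
    {ν : Measure Λ} (W : PeterWeylIso μ D ν) (UQ : UnitaryRep G HQ)
    (V : HTensor (L2 μ) (HTensor (L2 μ) HQ) →L[ℂ]
      HTensor (D.Space ν) (HTensor (L2 μ) HQ)) : Prop :=
  IsWeakIntegral μ (fun g (ξ, a, q) (a', b', q') =>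
    inner ℂ a (((leftReg μ g)†) a') * ketBra g g (W.X.symm ξ) b' *
      inner ℂ q (((UQ.op g)†) q')) V

/-- `T = ∫ (⊕ᵣ id ⊗ (Ustar r (g))†) ⊗ |g⁻¹⟩_A⟨g|_B ⊗ U_Q(g)† dg` from
`(⊕ᵣ H r ⊗ H r) ⊗ B ⊗ Q` to `(⊕ᵣ H r ⊗ H r) ⊗ A ⊗ Q`. -/
def IsTransformationFormula (D : IrrepField G H) (ν : Measure Λ) (UQ : UnitaryRep G HQ)
    (T : HTensor (D.Space ν) (HTensor (L2 μ) HQ) →L[ℂ]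
      HTensor (D.Space ν) (HTensor (L2 μ) HQ)) : Prop :=
  IsWeakIntegral μ (fun g (ξ, a, q) (ξ', b', q') =>
    inner ℂ ξ (D.rightOpAdj ν g ξ') * ketBra g⁻¹ g a b' *
      inner ℂ q (((UQ.op g)†) q')) T

end Regular

end QRF

end

noncomputable section

namespace QRF

open Filter Topology

/-! ### Totality of simple tensors and isometries from Gram matrices -/

section Hilbert

variable {E F K : Type*} [NormedAddCommGroup E] [InnerProductSpace ℂ E]
  [NormedAddCommGroup F] [InnerProductSpace ℂ F] [NormedAddCommGroup K] [InnerProductSpace ℂ K]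

-- Everything becomes a change of variables on `G × G`. The inverse of the Peter–Weyl map identifies
-- the first tensor factor with `L²(G)`, so a triple tensor product becomes `L²(G × G; K)`
-- (`prodEquiv`): product functions have the Gram matrix of simple tensors, and both families are
-- total.
--
-- In this picture the jump to `A` is `Ψ(g, h) ↦ U(g)⁻¹ Ψ(g, gh)`. The shear preserves the product
-- measure and `U(g)⁻¹` is unitary pointwise, so this is an isometry with an explicit inverse.
-- Fubini turns its matrix elements into the required weak integral (`inner_jumpA`). The jump to `B`
-- is the same map after exchanging the variables.
--
-- Eliminating `Ψ` from the two jumps leaves `Ψ(g, h) ↦ U(h) Ψ(gh, h⁻¹)`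
-- (`transformationIsometry_jumpIso`). Here the first frame is hit by a right translation, which the
-- Peter–Weyl map carries to the operators on the multiplicity spaces; substituting `h = g⁻¹` gives
-- the stated formula (`inner_transformation`).
--
-- A bounded operator is determined by its matrix elements between simple tensors
-- (`IsWeakIntegral.unique`). This gives all the uniqueness claims. It also gives independence of
-- the Peter–Weyl isomorphism, which no longer occurs in the formula for the transformation.

theorem dense_span_range_iff {ι X : Type*} [NormedAddCommGroup X] [InnerProductSpace ℂ X]
    [CompleteSpace X] (f : ι → X) :
    Dense (Submodule.span ℂ (Set.range f) : Set X) ↔ ∀ z, (∀ i, inner ℂ (f i) z = 0) → z = 0 := by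
  rw [Submodule.dense_iff_topologicalClosure_eq_top, Submodule.topologicalClosure_eq_top_iff,
    Submodule.eq_bot_iff]
  refine forall_congr' fun z => imp_congr_left ?_
  rw [Submodule.mem_orthogonal]
  refine ⟨fun h i => h _ (Submodule.subset_span ⟨i, rfl⟩), fun h u hu => ?_⟩
  induction hu using Submodule.span_induction with
  | mem x hx => obtain ⟨i, rfl⟩ := hx; exact h i
  | zero => simp
  | add x y _ _ hx hy => rw [inner_add_left, hx, hy, add_zero]
  | smul c x _ hx => rw [inner_smul_left, hx, mul_zero]

/-- Two total families with the same Gram matrix are related by a unitary. -/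
theorem exists_isometry_of_gram {ι X Z : Type*} [NormedAddCommGroup X] [InnerProductSpace ℂ X]
    [CompleteSpace X] [NormedAddCommGroup Z] [InnerProductSpace ℂ Z] [CompleteSpace Z]
    (f : ι → X) (h : ι → Z) (gram : ∀ i j, inner ℂ (f i) (f j) = inner ℂ (h i) (h j))
    (hf : Dense (Submodule.span ℂ (Set.range f) : Set X))
    (hh : Dense (Submodule.span ℂ (Set.range h) : Set Z)) :
    ∃ T : X ≃ₗᵢ[ℂ] Z, ∀ i, T (f i) = h i := by
  -- Both maps out of `ι →₀ ℂ` have dense range, and equal Gram matrices mean that they pull back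
  -- the same seminorm. Hence the identity of `ι →₀ ℂ` extends to a unitary.
  let e := Finsupp.linearCombination ℂ f
  let e' := Finsupp.linearCombination ℂ h
  have he : DenseRange e := by
    rw [← Finsupp.range_linearCombination] at hf; exact hf
  have he' : DenseRange e' := by
    rw [← Finsupp.range_linearCombination] at hh; exact hh
  have hin : ∀ x, inner ℂ (e' x) (e' x) = inner ℂ (e x) (e x) := fun x => by
    simp only [e, e', Finsupp.linearCombination_apply, Finsupp.sum, sum_inner, inner_sum,
      inner_smul_left, inner_smul_right, gram]
  have hn : ∀ x, ‖e' x‖ = ‖e x‖ := fun x => by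
    rw [norm_eq_sqrt_re_inner (𝕜 := ℂ), norm_eq_sqrt_re_inner (𝕜 := ℂ), hin]
  refine ⟨(LinearEquiv.refl ℂ (ι →₀ ℂ)).extendOfIsometry e e' he he' hn, fun i => ?_⟩
  have := (LinearEquiv.refl ℂ (ι →₀ ℂ)).extendOfIsometry_eq e e' he he' hn (Finsupp.single i 1)
  simpa [e, e'] using this

theorem continuous_tmul_right (x : E) : Continuous fun z : F => tmul x z :=
  (UniformSpace.Completion.continuous_coe _).comp
    ((TensorProduct.mkL ℂ E F x).continuous)

theorem eq_zero_of_inner_tmul (z : HTensor E F) (h : ∀ x y, inner ℂ (tmul x y) z = 0) : z = 0 := by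
  rw [← inner_self_eq_zero (𝕜 := ℂ)]
  suffices H : ∀ w : HTensor E F, inner ℂ w z = 0 from H z
  intro w
  induction w using UniformSpace.Completion.induction_on with
  | hp => exact isClosed_eq (by fun_prop) (by fun_prop)
  | ih w =>
    induction w using TensorProduct.induction_on with
    | zero => rw [UniformSpace.Completion.coe_zero, inner_zero_left]
    | tmul a b => exact h a b
    | add a b ha hb => rw [UniformSpace.Completion.coe_add, inner_add_left, ha, hb, add_zero]

theorem tmul_add' (x : E) (y z : F) : tmul x (y + z) = tmul x y + tmul x z := by
  simp only [tmul, TensorProduct.tmul_add, UniformSpace.Completion.coe_add]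

/-- The second factor is itself a completion, so the density argument is needed once more inside it,
using continuity of `tmul x`. -/
theorem eq_zero_of_inner_tmul₃ (z : HTensor E (HTensor F K))
    (h : ∀ x y w, inner ℂ (tmul₃ x y w) z = 0) : z = 0 := by
  refine eq_zero_of_inner_tmul z fun x v => ?_
  induction v using UniformSpace.Completion.induction_on with
  | hp =>
    exact isClosed_eq (Continuous.inner (continuous_tmul_right x) continuous_const) continuous_const
  | ih v =>
    induction v using TensorProduct.induction_on with
    | zero => rw [UniformSpace.Completion.coe_zero, tmul_zero', inner_zero_left]
    | tmul a b => exact h x a b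
    | add a b ha hb =>
      rw [UniformSpace.Completion.coe_add, tmul_add', inner_add_left, ha, hb, add_zero]

theorem dense_span_tmul₃ : Dense (Submodule.span ℂ (Set.range fun i : E × F × K =>
    tmul₃ i.1 i.2.1 i.2.2) : Set (HTensor E (HTensor F K))) :=
  (dense_span_range_iff _).2 fun z hz => eq_zero_of_inner_tmul₃ z fun x y w => hz (x, y, w)

theorem inner_tmul₃_tmul₃ (x x' : E) (y y' : F) (w w' : K) :
    inner ℂ (tmul₃ x y w) (tmul₃ x' y' w') =
      inner ℂ x x' * inner ℂ y y' * inner ℂ w w' := by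
  rw [tmul₃, tmul₃, inner_tmul_tmul, inner_tmul_tmul, mul_assoc]

/-- Simple tensors are total on both sides, so the integrals of the kernel fix every matrix element
of a bounded operator. -/
theorem IsWeakIntegral.unique {G : Type*} [MeasurableSpace G] {μ : Measure G}
    {E₁ E₂ E₃ F₁ F₂ F₃ : Type*}
    [NormedAddCommGroup E₁] [InnerProductSpace ℂ E₁]
    [NormedAddCommGroup E₂] [InnerProductSpace ℂ E₂]
    [NormedAddCommGroup E₃] [InnerProductSpace ℂ E₃]
    [NormedAddCommGroup F₁] [InnerProductSpace ℂ F₁]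
    [NormedAddCommGroup F₂] [InnerProductSpace ℂ F₂]
    [NormedAddCommGroup F₃] [InnerProductSpace ℂ F₃]
    {m : G → F₁ × F₂ × F₃ → E₁ × E₂ × E₃ → ℂ}
    {T T' : HTensor E₁ (HTensor E₂ E₃) →L[ℂ] HTensor F₁ (HTensor F₂ F₃)}
    (hT : IsWeakIntegral μ m T) (hT' : IsWeakIntegral μ m T') : T = T' := by
  refine ContinuousLinearMap.ext_on dense_span_tmul₃ ?_
  rintro _ ⟨y, rfl⟩
  rw [← sub_eq_zero]
  refine eq_zero_of_inner_tmul₃ _ fun x₁ x₂ x₃ => ?_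
  rw [inner_sub_right, sub_eq_zero]
  exact ((hT (x₁, x₂, x₃) y).2).trans ((hT' (x₁, x₂, x₃) y).2).symm

-- Joint continuity of unitary representations

/-- Strong continuity alone is separate continuity; since all `U(g)` are isometric, `‖U(g)v -
U(g₀)v₀‖ ≤ ‖v - v₀‖ + ‖U(g)v₀ - U(g₀)v₀‖`. Joint continuity is what makes `p ↦ U(c(p)) f(p)`
measurable. -/
theorem UnitaryRep.continuous_uncurry {G : Type*} [Group G] [TopologicalSpace G]
    (U : UnitaryRep G E) : Continuous fun p : G × E => U.op p.1 p.2 := by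
  rw [continuous_iff_continuousAt]
  rintro ⟨g₀, v₀⟩
  rw [ContinuousAt, tendsto_iff_norm_sub_tendsto_zero]
  have hlim : Tendsto (fun p : G × E => ‖p.2 - v₀‖ + ‖U.op p.1 v₀ - U.op g₀ v₀‖)
      (𝓝 (g₀, v₀)) (𝓝 0) := by
    have hc : Continuous fun p : G × E => ‖p.2 - v₀‖ + ‖U.op p.1 v₀ - U.op g₀ v₀‖ :=
      (by fun_prop : Continuous fun p : G × E => ‖p.2 - v₀‖).add
        ((((U.continuous_apply v₀).comp continuous_fst).sub continuous_const).norm)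
    simpa using hc.tendsto (g₀, v₀)
  refine squeeze_zero (fun _ => norm_nonneg _) (fun p => ?_) hlim
  calc ‖U.op p.1 p.2 - U.op g₀ v₀‖
      = ‖U.op p.1 (p.2 - v₀) + (U.op p.1 v₀ - U.op g₀ v₀)‖ := by rw [map_sub]; congr 1; abel
    _ ≤ _ := (norm_add_le _ _).trans (by rw [U.norm_op_apply])

theorem UnitaryRep.op_mul_apply {G : Type*} [Group G] [TopologicalSpace G]
    (U : UnitaryRep G E) (g h : G) (v : E) : U.op g (U.op h v) = U.op (g * h) v := by
  change (U.toHom g * U.toHom h) v = U.toHom (g * h) v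
  rw [map_mul]

theorem UnitaryRep.op_one_apply {G : Type*} [Group G] [TopologicalSpace G]
    (U : UnitaryRep G E) (v : E) : U.op 1 v = v := by
  change U.toHom 1 v = v
  rw [map_one]; rfl

end Hilbert

/-! ### Twisted composition operators -/

section Twisted

variable {α G K : Type*} [MeasurableSpace α] {m : Measure α} [NormedAddCommGroup K]
  [InnerProductSpace ℂ K]
  [Group G] [TopologicalSpace G] [T2Space G] [IsTopologicalGroup G] [LocallyCompactSpace G]
  [SecondCountableTopology G] [MeasurableSpace G] [BorelSpace G]

theorem aestronglyMeasurable_op (U : UnitaryRep G K) {c : α → G} (hc : Measurable c) {f : α → K}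
    (hf : AEStronglyMeasurable f m) : AEStronglyMeasurable (fun p => U.op (c p) (f p)) m := by
  -- Metrizability together with second countability makes the measurable map `c` strongly
  -- measurable.
  have := TopologicalSpace.metrizableSpace_of_t3_secondCountable G
  exact U.continuous_uncurry.comp_aestronglyMeasurable
    (hc.stronglyMeasurable.aestronglyMeasurable.prodMk hf)

theorem memLp_twistedComp (U : UnitaryRep G K) {c : α → G} (hc : Measurable c) {θ : α → α}
    (hθ : MeasurePreserving θ m m) (Ψ : Lp K 2 m) :
    MemLp (fun p => U.op (c p) (Ψ (θ p))) 2 m :=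
  ((Lp.memLp Ψ).comp_measurePreserving hθ).of_le
    (aestronglyMeasurable_op U hc ((Lp.memLp Ψ).comp_measurePreserving hθ).1)
    (Eventually.of_forall fun _ => (U.norm_op_apply _ _).le)

/-- The isometry `Ψ ↦ (p ↦ U(c(p)) Ψ(θ(p)))` of `L²(α; K)`. -/
def twistedComp (U : UnitaryRep G K) (c : α → G) (hc : Measurable c) (θ : α → α)
    (hθ : MeasurePreserving θ m m) : Lp K 2 m →ₗᵢ[ℂ] Lp K 2 m where
  toFun Ψ := (memLp_twistedComp U hc hθ Ψ).toLp _
  map_add' Ψ Φ := by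
    refine Lp.ext ?_
    filter_upwards [(memLp_twistedComp U hc hθ (Ψ + Φ)).coeFn_toLp,
      (memLp_twistedComp U hc hθ Ψ).coeFn_toLp, (memLp_twistedComp U hc hθ Φ).coeFn_toLp,
      Lp.coeFn_add ((memLp_twistedComp U hc hθ Ψ).toLp _) ((memLp_twistedComp U hc hθ Φ).toLp _),
      hθ.quasiMeasurePreserving.ae (Lp.coeFn_add Ψ Φ)] with p h1 h2 h3 h4 h5
    rw [h1, h4, Pi.add_apply, h2, h3, h5, Pi.add_apply, map_add]
  map_smul' a Ψ := by
    refine Lp.ext ?_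
    filter_upwards [(memLp_twistedComp U hc hθ (a • Ψ)).coeFn_toLp,
      (memLp_twistedComp U hc hθ Ψ).coeFn_toLp,
      Lp.coeFn_smul a ((memLp_twistedComp U hc hθ Ψ).toLp _),
      hθ.quasiMeasurePreserving.ae (Lp.coeFn_smul a Ψ)] with p h1 h2 h4 h5
    rw [h1, RingHom.id_apply, h4, Pi.smul_apply, h2, h5, Pi.smul_apply, map_smul]
  norm_map' Ψ := by
    rw [LinearMap.coe_mk, AddHom.coe_mk, Lp.norm_toLp, Lp.norm_def]
    congr 1
    -- The map `θ` preserves the norm integral, and `U(c(p))` preserves the norm at each point.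
    rw [← eLpNorm_comp_measurePreserving (Lp.aestronglyMeasurable Ψ) hθ]
    exact eLpNorm_congr_norm_ae (Eventually.of_forall fun p => U.norm_op_apply _ _)

theorem coeFn_twistedComp (U : UnitaryRep G K) {c : α → G} (hc : Measurable c) {θ : α → α}
    (hθ : MeasurePreserving θ m m) (Ψ : Lp K 2 m) :
    twistedComp U c hc θ hθ Ψ =ᵐ[m] fun p => U.op (c p) (Ψ (θ p)) :=
  (memLp_twistedComp U hc hθ Ψ).coeFn_toLp

/-- The almost-everywhere description of the inner operator may be pulled back along `θ`, because
preimages of null sets are null. The twists then multiply by the cocycle rule `c · (c' ∘ θ)`. -/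
theorem coeFn_twistedComp_twistedComp (U : UnitaryRep G K) {c c' : α → G} (hc : Measurable c)
    (hc' : Measurable c') {θ θ' : α → α} (hθ : MeasurePreserving θ m m)
    (hθ' : MeasurePreserving θ' m m) (Ψ : Lp K 2 m) :
    twistedComp U c hc θ hθ (twistedComp U c' hc' θ' hθ' Ψ) =ᵐ[m]
      fun p => U.op (c p * c' (θ p)) (Ψ (θ' (θ p))) := by
  filter_upwards [coeFn_twistedComp U hc hθ (twistedComp U c' hc' θ' hθ' Ψ),
    hθ.quasiMeasurePreserving.ae (coeFn_twistedComp U hc' hθ' Ψ)] with p h1 h2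
  rw [h1, h2, U.op_mul_apply]

/-- Provides right inverses; as twisted compositions are isometries, surjectivity is all that
unitarity still requires. -/
theorem twistedComp_twistedComp_eq_self (U : UnitaryRep G K) {c c' : α → G} (hc : Measurable c)
    (hc' : Measurable c') {θ θ' : α → α} (hθ : MeasurePreserving θ m m)
    (hθ' : MeasurePreserving θ' m m) (h1 : ∀ p, c p * c' (θ p) = 1) (h2 : ∀ p, θ' (θ p) = p)
    (Ψ : Lp K 2 m) :
    twistedComp U c hc θ hθ (twistedComp U c' hc' θ' hθ' Ψ) = Ψ := by
  refine Lp.ext ((coeFn_twistedComp_twistedComp U hc hc' hθ hθ' Ψ).trans ?_)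
  exact Eventually.of_forall fun p => by simp only [h1, h2, U.op_one_apply]

end Twisted

/-! ### Product vectors in `L²(G × G; K)` -/

section ProdVec

variable {G K : Type*} [MeasurableSpace G] {μ : Measure G}
  [NormedAddCommGroup K] [InnerProductSpace ℂ K]

theorem memLp_prod_smul (a b : L2 μ) (q : K) :
    MemLp (fun p : G × G => (a p.1 * b p.2) • q) 2 (μ.prod μ) := by
  have hab : AEStronglyMeasurable (fun p : G × G => a p.1 * b p.2) (μ.prod μ) :=
    (Lp.aestronglyMeasurable a).comp_fst.mul (Lp.aestronglyMeasurable b).comp_snd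
  have hm : AEStronglyMeasurable (fun p : G × G => (a p.1 * b p.2) • q) (μ.prod μ) :=
    hab.smul_const q
  rw [memLp_two_iff_integrable_sq_norm hm]
  have hsq : ∀ c : L2 μ, Integrable (fun g => ‖c g‖ ^ 2) μ := fun c =>
    (memLp_two_iff_integrable_sq_norm (Lp.aestronglyMeasurable c)).1 (Lp.memLp c)
  have h := ((hsq a).mul_prod (hsq b)).mul_const (‖q‖ ^ 2)
  refine h.congr (Eventually.of_forall fun p => ?_)
  simp only [norm_smul, norm_mul, mul_pow]

/-- The vector `(g, h) ↦ a(g) b(h) q` of `L²(G × G; K)`. -/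
def prodVec (a b : L2 μ) (q : K) : Lp K 2 (μ.prod μ) := (memLp_prod_smul a b q).toLp _

theorem coeFn_prodVec (a b : L2 μ) (q : K) :
    prodVec a b q =ᵐ[μ.prod μ] fun p => (a p.1 * b p.2) • q :=
  (memLp_prod_smul a b q).coeFn_toLp

variable [SigmaFinite μ]

/-- Fubini factorizes the integral. The value is the Gram matrix of simple tensors, as needed to
identify the two Hilbert spaces. -/
theorem inner_prodVec_prodVec (a a' b b' : L2 μ) (q q' : K) :
    inner ℂ (prodVec a b q) (prodVec a' b' q') =
      inner ℂ a a' * inner ℂ b b' * inner ℂ q q' := by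
  rw [L2.inner_def, L2.inner_def, L2.inner_def, ← integral_prod_mul, ← integral_mul_const]
  refine integral_congr_ae ?_
  filter_upwards [coeFn_prodVec a b q, coeFn_prodVec a' b' q'] with p h1 h2
  rw [h1, h2, inner_smul_left, inner_smul_right]
  simp only [RCLike.inner_apply, map_mul]
  ring

theorem setIntegral_prod_eq_zero [CompleteSpace K] (Ψ : Lp K 2 (μ.prod μ))
    (h : ∀ a b q, inner ℂ (prodVec a b q) Ψ = 0)
    {s t : Set G} (hs : MeasurableSet s) (ht : MeasurableSet t) (hμs : μ s ≠ ⊤) (hμt : μ t ≠ ⊤) :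
    ∫ p in s ×ˢ t, Ψ p ∂(μ.prod μ) = 0 := by
  have hst : (μ.prod μ) (s ×ˢ t) ≠ ⊤ := by
    rw [Measure.prod_prod]; exact ENNReal.mul_ne_top hμs hμt
  have hint : IntegrableOn Ψ (s ×ˢ t) (μ.prod μ) :=
    integrableOn_Lp_of_measure_ne_top Ψ fact_one_le_two_ennreal.out hst
  rw [← inner_self_eq_zero (𝕜 := ℂ)]
  -- Testing against `1_s ⊗ 1_t ⊗ q`, with `q` the integral itself, gives `⟨q, q⟩ = 0`. A single
  -- test vector suffices, so no separability of `K` is needed.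
  set q := ∫ p in s ×ˢ t, Ψ p ∂(μ.prod μ) with hq
  rw [hq, ← integral_inner hint q]
  rw [← h (indicatorConstLp 2 hs hμs 1) (indicatorConstLp 2 ht hμt 1) q, L2.inner_def,
    ← integral_indicator (hs.prod ht)]
  refine integral_congr_ae ?_
  filter_upwards [coeFn_prodVec (indicatorConstLp 2 hs hμs (1 : ℂ))
      (indicatorConstLp 2 ht hμt (1 : ℂ)) q,
    Measure.quasiMeasurePreserving_fst.ae
      (indicatorConstLp_coeFn (p := 2) (hs := hs) (hμs := hμs) (c := (1 : ℂ))),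
    Measure.quasiMeasurePreserving_snd.ae
      (indicatorConstLp_coeFn (p := 2) (hs := ht) (hμs := hμt) (c := (1 : ℂ)))] with p h1 h2 h3
  rw [h1, h2, h3]
  by_cases hps : p.1 ∈ s <;> by_cases hpt : p.2 ∈ t <;> simp [Set.indicator, hps, hpt]

/-- The integrals of `Ψ` vanish over finite-measure rectangles, a π-system generating the product
σ-algebra once arbitrary rectangles are cut down to a square `D n`. As `Ψ` need only be integrable
on sets of finite measure, the Dynkin argument runs inside each `D n`, and these exhaust `G × G`. -/
theorem eq_zero_of_inner_prodVec [CompleteSpace K] (Ψ : Lp K 2 (μ.prod μ))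
    (h : ∀ a b q, inner ℂ (prodVec a b q) Ψ = 0) : Ψ = 0 := by
  let S : ℕ → Set G := spanningSets μ
  have hS : ∀ n, MeasurableSet (S n) := measurableSet_spanningSets μ
  have hμS : ∀ n, μ (S n) ≠ ⊤ := fun n => (measure_spanningSets_lt_top μ n).ne
  let D : ℕ → Set (G × G) := fun n => S n ×ˢ S n
  have hD : ⋃ n, D n = Set.univ := by
    rw [Set.iUnion_prod_of_monotone (monotone_spanningSets μ) (monotone_spanningSets μ),
      iUnion_spanningSets, Set.univ_prod_univ]
  have hDfin : ∀ n, (μ.prod μ) (D n) ≠ ⊤ := fun n => by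
    rw [Measure.prod_prod]; exact ENNReal.mul_ne_top (hμS n) (hμS n)
  have hint : ∀ n, Integrable Ψ ((μ.prod μ).restrict (D n)) := fun n =>
    integrableOn_Lp_of_measure_ne_top Ψ fact_one_le_two_ennreal.out (hDfin n)
  have hzero : ∀ n, ∀ s, MeasurableSet s → ∫ p in s, Ψ p ∂((μ.prod μ).restrict (D n)) = 0 := by
    intro n s hs
    induction s, hs using MeasurableSpace.induction_on_inter generateFrom_prod.symm
      isPiSystem_prod with
    | empty => simp
    | basic s hs =>
      obtain ⟨A, hA, B, hB, rfl⟩ := hs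
      rw [Measure.restrict_restrict (hA.prod hB), Set.prod_inter_prod]
      exact setIntegral_prod_eq_zero Ψ h (hA.inter (hS n)) (hB.inter (hS n))
        (measure_ne_top_of_subset Set.inter_subset_right (hμS n))
        (measure_ne_top_of_subset Set.inter_subset_right (hμS n))
    -- The total integral over `D n` also vanishes, since `D n` is itself a rectangle.
    | compl s hs ih =>
      rw [setIntegral_compl hs (hint n), ih, sub_zero]
      exact setIntegral_prod_eq_zero Ψ h (hS n) (hS n) (hμS n) (hμS n)
    | iUnion f hd hm ih =>
      rw [integral_iUnion hm hd (hint n).integrableOn]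
      simp [ih]
  have hall : ∀ᵐ p ∂(μ.prod μ).restrict (⋃ n, D n), Ψ p = 0 :=
    (ae_restrict_iUnion_iff D _).2 fun n => (hint n).ae_eq_zero_of_forall_setIntegral_eq_zero fun s hs _ => hzero n s hs
  rw [hD, Measure.restrict_univ] at hall
  exact (Lp.eq_zero_iff_ae_eq_zero).2 hall

/-- `E ⊗ L²(G) ⊗ K` is `L²(G × G; K)` for every space `E` identified with `L²(G)`. -/
theorem exists_isometry_prodVec [CompleteSpace K] {E : Type*} [NormedAddCommGroup E]
    [InnerProductSpace ℂ E] (Y : E ≃ₗᵢ[ℂ] L2 μ) :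
    ∃ J : HTensor E (HTensor (L2 μ) K) ≃ₗᵢ[ℂ] Lp K 2 (μ.prod μ),
      ∀ ξ b q, J (tmul₃ ξ b q) = prodVec (Y ξ) b q := by
  obtain ⟨J, hJ⟩ := exists_isometry_of_gram
    (fun i : E × L2 μ × K => tmul₃ i.1 i.2.1 i.2.2)
    (fun i : E × L2 μ × K => prodVec (Y i.1) i.2.1 i.2.2)
    (fun i j => by rw [inner_tmul₃_tmul₃, inner_prodVec_prodVec, Y.inner_map_map])
    dense_span_tmul₃
    ((dense_span_range_iff _).2 fun z hz => eq_zero_of_inner_prodVec z fun a b q => by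
      simpa using hz (Y.symm a, b, q))
  exact ⟨J, fun ξ b q => hJ (ξ, b, q)⟩

/-- The identification of `E ⊗ L²(G) ⊗ K` with `L²(G × G; K)` given by one of `E` with `L²(G)`. -/
def prodEquiv [CompleteSpace K] {E : Type*} [NormedAddCommGroup E]
    [InnerProductSpace ℂ E] (Y : E ≃ₗᵢ[ℂ] L2 μ) :
    HTensor E (HTensor (L2 μ) K) ≃ₗᵢ[ℂ] Lp K 2 (μ.prod μ) :=
  (exists_isometry_prodVec Y).choose

theorem prodEquiv_tmul₃ [CompleteSpace K] {E : Type*} [NormedAddCommGroup E]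
    [InnerProductSpace ℂ E] (Y : E ≃ₗᵢ[ℂ] L2 μ) (ξ : E) (b : L2 μ) (q : K) :
    prodEquiv Y (tmul₃ ξ b q) = prodVec (Y ξ) b q :=
  (exists_isometry_prodVec Y).choose_spec ξ b q

end ProdVec

/-! ### Jumps and transformations on `L²(G × G; K)` -/

section Jumps

variable {G : Type*} [Group G] [TopologicalSpace G] [IsTopologicalGroup G]
  [LocallyCompactSpace G] [T2Space G] [SecondCountableTopology G] [MeasurableSpace G]
  [BorelSpace G] {μ : Measure G} [SigmaFinite μ]
  {K : Type*} [NormedAddCommGroup K] [InnerProductSpace ℂ K]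

omit [SigmaFinite μ] in
theorem coeFn_twistedComp_prodVec (U : UnitaryRep G K) {c : G × G → G} (hc : Measurable c)
    {θ : G × G → G × G} (hθ : MeasurePreserving θ (μ.prod μ) (μ.prod μ)) (a b : L2 μ) (q : K) :
    twistedComp U c hc θ hθ (prodVec a b q) =ᵐ[μ.prod μ]
      fun p => (a (θ p).1 * b (θ p).2) • U.op (c p) q := by
  filter_upwards [coeFn_twistedComp U hc hθ (prodVec a b q),
    hθ.quasiMeasurePreserving.ae (coeFn_prodVec a b q)] with p h1 h2
  rw [h1, h2, map_smul]

-- The integrand is the pointwise inner product of two `L²` functions on `G × G`. Its joint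
-- integrability licenses Fubini in either order.
omit [SigmaFinite μ] in
theorem inner_prodVec_twistedComp (U : UnitaryRep G K) {c : G × G → G} (hc : Measurable c)
    {θ : G × G → G × G} (hθ : MeasurePreserving θ (μ.prod μ) (μ.prod μ)) (a b a' b' : L2 μ)
    (q q' : K) :
    Integrable (fun p => conj (a p.1 * b p.2) * (a' (θ p).1 * b' (θ p).2) *
        inner ℂ q (U.op (c p) q')) (μ.prod μ) ∧
      inner ℂ (prodVec a b q) (twistedComp U c hc θ hθ (prodVec a' b' q')) =
        ∫ p, conj (a p.1 * b p.2) * (a' (θ p).1 * b' (θ p).2) *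
          inner ℂ q (U.op (c p) q') ∂(μ.prod μ) := by
  have h : (fun p => inner ℂ (prodVec a b q p)
      (twistedComp U c hc θ hθ (prodVec a' b' q') p)) =ᵐ[μ.prod μ]
      fun p => conj (a p.1 * b p.2) * (a' (θ p).1 * b' (θ p).2) *
        inner ℂ q (U.op (c p) q') := by
    filter_upwards [coeFn_prodVec a b q, coeFn_twistedComp_prodVec U hc hθ a' b' q'] with p h1 h2
    rw [h1, h2, inner_smul_left, inner_smul_right]; ring
  exact ⟨(L2.integrable_inner _ _).congr h, by rw [L2.inner_def]; exact integral_congr_ae h⟩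

-- Moving the adjoint to the other side gives `b(g⁻¹x)` against `b'(x)`; left invariance then allows
-- `x = gh`.
omit [LocallyCompactSpace G] [T2Space G] [SecondCountableTopology G] [SigmaFinite μ] in
theorem inner_leftReg_adjoint [μ.IsMulLeftInvariant] (g : G) (b b' : L2 μ) :
    inner ℂ b (((leftReg μ g)†) b') = ∫ h, conj (b h) * b' (g * h) ∂μ := by
  rw [ContinuousLinearMap.adjoint_inner_right, L2.inner_def,
    ← integral_mul_left_eq_self _ g]
  refine integral_congr_ae ?_
  have h := (measurePreserving_mul_left μ g).quasiMeasurePreserving.ae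
    (Lp.coeFn_compMeasurePreserving b (measurePreserving_mul_left μ g⁻¹))
  filter_upwards [h] with x hx
  change inner ℂ (Lp.compMeasurePreserving _ (measurePreserving_mul_left μ g⁻¹) b (g * x)) _ = _
  rw [hx, Function.comp_apply, inv_mul_cancel_left, RCLike.inner_apply, mul_comm]

omit [LocallyCompactSpace G] [T2Space G] [SecondCountableTopology G] [SigmaFinite μ] in
theorem inner_rightReg [μ.IsMulRightInvariant] (g : G) (a a' : L2 μ) :
    inner ℂ a (rightReg μ g a') = ∫ k, conj (a k) * a' (k * g) ∂μ := by
  rw [L2.inner_def]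
  refine integral_congr_ae ?_
  filter_upwards [Lp.coeFn_compMeasurePreserving a' (measurePreserving_mul_right μ g)] with x hx
  change inner ℂ _ (Lp.compMeasurePreserving _ (measurePreserving_mul_right μ g) a' x) = _
  rw [hx, Function.comp_apply, RCLike.inner_apply, mul_comm]

variable (μ) in
/-- `Ψ(g, h) ↦ U(g)† Ψ(g, g h)`. -/
def jumpIso [μ.IsMulLeftInvariant] (U : UnitaryRep G K) :
    Lp K 2 (μ.prod μ) ≃ₗᵢ[ℂ] Lp K 2 (μ.prod μ) :=
  LinearIsometryEquiv.ofSurjective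
    (twistedComp U (fun p : G × G => p.1⁻¹) measurable_fst.inv (fun p => (p.1, p.1 * p.2))
      (measurePreserving_prod_mul μ μ))
    -- The preimage is `U(g) Ψ(g, g⁻¹h)`: the inverse shear with the inverse twist.
    (fun Ψ => ⟨twistedComp U (fun p : G × G => p.1) measurable_fst (fun p => (p.1, p.1⁻¹ * p.2))
      (measurePreserving_prod_inv_mul μ μ) Ψ,
      twistedComp_twistedComp_eq_self U _ _ _ _ (fun p => inv_mul_cancel p.1)
        (fun _ => Prod.ext rfl (inv_mul_cancel_left _ _)) Ψ⟩)

theorem jumpIso_apply [μ.IsMulLeftInvariant] (U : UnitaryRep G K) (Ψ : Lp K 2 (μ.prod μ)) :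
    jumpIso μ U Ψ = twistedComp U (fun p : G × G => p.1⁻¹) measurable_fst.inv
      (fun p => (p.1, p.1 * p.2)) (measurePreserving_prod_mul μ μ) Ψ :=
  congrFun (LinearIsometryEquiv.coe_ofSurjective _ _) Ψ

variable (μ) in
/-- `Ψ(g, h) ↦ Ψ(h, g)`. -/
def swapIso (U : UnitaryRep G K) : Lp K 2 (μ.prod μ) ≃ₗᵢ[ℂ] Lp K 2 (μ.prod μ) :=
  LinearIsometryEquiv.ofSurjective
    -- The trivial twist makes `U` immaterial here, and keeps the exchange within the scope of the
    -- composition rule.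
    (twistedComp U (fun _ : G × G => (1 : G)) measurable_const Prod.swap Measure.measurePreserving_swap)
    (fun Ψ => ⟨twistedComp U (fun _ : G × G => (1 : G)) measurable_const Prod.swap
      Measure.measurePreserving_swap Ψ,
      twistedComp_twistedComp_eq_self U (measurable_const (a := (1 : G))) measurable_const
        Measure.measurePreserving_swap Measure.measurePreserving_swap (fun _ => one_mul (1 : G))
        Prod.swap_swap Ψ⟩)

theorem swapIso_apply (U : UnitaryRep G K) (Ψ : Lp K 2 (μ.prod μ)) :
    swapIso μ U Ψ = twistedComp U (fun _ : G × G => (1 : G)) measurable_const Prod.swap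
      Measure.measurePreserving_swap Ψ :=
  congrFun (LinearIsometryEquiv.coe_ofSurjective _ _) Ψ

theorem swapIso_prodVec (U : UnitaryRep G K) (a b : L2 μ) (q : K) :
    swapIso μ U (prodVec a b q) = prodVec b a q := by
  rw [swapIso_apply]
  refine Lp.ext ?_
  filter_upwards [coeFn_prodVec b a q,
    coeFn_twistedComp_prodVec U (measurable_const (a := (1 : G)))
      Measure.measurePreserving_swap a b q]
    with p h1 h2
  rw [h1, mul_comm]
  refine h2.trans ?_
  rw [U.op_one_apply]; rfl

-- Right invariance handles `(g, h) ↦ (gh, h)`, and inversion invariance the second coordinate.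
omit [LocallyCompactSpace G] [T2Space G] in
theorem measurePreserving_mul_inv_snd [μ.IsMulRightInvariant] [μ.IsInvInvariant] :
    MeasurePreserving (fun p : G × G => (p.1 * p.2, p.2⁻¹)) (μ.prod μ) (μ.prod μ) :=
  ((MeasurePreserving.id μ).prod (Measure.measurePreserving_inv μ)).comp
    (measurePreserving_mul_prod μ μ)

variable (μ) in
/-- `Ψ(g, h) ↦ U(h) Ψ(g h, h⁻¹)`. -/
def transformationIsometry [μ.IsMulRightInvariant] [μ.IsInvInvariant] (U : UnitaryRep G K) :
    Lp K 2 (μ.prod μ) →ₗᵢ[ℂ] Lp K 2 (μ.prod μ) :=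
  twistedComp U (fun p : G × G => p.2) measurable_snd (fun p => (p.1 * p.2, p.2⁻¹))
    measurePreserving_mul_inv_snd

/-- Both sides are `(g, h) ↦ U(g)⁻¹ Ψ(gh, g)`: on the left, `h(gh)⁻¹ = g⁻¹` and `(gh)h⁻¹ = g`. This
is the core identity `V^{A→B} V^{→A} = V^{→B}`. -/
theorem transformationIsometry_jumpIso [μ.IsMulLeftInvariant] [μ.IsMulRightInvariant]
    [μ.IsInvInvariant] (U : UnitaryRep G K) (Ψ : Lp K 2 (μ.prod μ)) :
    transformationIsometry μ U (jumpIso μ U Ψ) = jumpIso μ U (swapIso μ U Ψ) := by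
  rw [jumpIso_apply, jumpIso_apply, swapIso_apply]
  refine Lp.ext ?_
  filter_upwards [coeFn_twistedComp_twistedComp U measurable_snd measurable_fst.inv
      measurePreserving_mul_inv_snd (measurePreserving_prod_mul μ μ) Ψ,
    coeFn_twistedComp_twistedComp U measurable_fst.inv
      (measurable_const (a := (1 : G)))      (measurePreserving_prod_mul μ μ) Measure.measurePreserving_swap Ψ] with p h1 h2
  refine h1.trans (Eq.trans ?_ h2.symm)
  simp

variable [CompleteSpace K] {E : Type*} [NormedAddCommGroup E] [InnerProductSpace ℂ E]

/-- The jump into the perspective of the first frame, whose space is identified with `E`. -/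
def jumpA [μ.IsMulLeftInvariant] (Y : E ≃ₗᵢ[ℂ] L2 μ) (U : UnitaryRep G K) :
    HTensor (L2 μ) (HTensor (L2 μ) K) ≃ₗᵢ[ℂ] HTensor E (HTensor (L2 μ) K) :=
  (prodEquiv (.refl ℂ _)).trans ((jumpIso μ U).trans (prodEquiv Y).symm)

/-- The jump into the perspective of the second frame, whose space is identified with `E`. -/
def jumpB [μ.IsMulLeftInvariant] (Y : E ≃ₗᵢ[ℂ] L2 μ) (U : UnitaryRep G K) :
    HTensor (L2 μ) (HTensor (L2 μ) K) ≃ₗᵢ[ℂ] HTensor E (HTensor (L2 μ) K) :=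
  (prodEquiv (.refl ℂ _)).trans ((swapIso μ U).trans ((jumpIso μ U).trans (prodEquiv Y).symm))

theorem jumpB_tmul₃ [μ.IsMulLeftInvariant] (Y : E ≃ₗᵢ[ℂ] L2 μ) (U : UnitaryRep G K)
    (a b : L2 μ) (q : K) : jumpB Y U (tmul₃ a b q) = jumpA Y U (tmul₃ b a q) := by
  simp [jumpA, jumpB, prodEquiv_tmul₃, swapIso_prodVec]

theorem jumpB_jumpA_symm [μ.IsMulLeftInvariant] [μ.IsMulRightInvariant] [μ.IsInvInvariant]
    (Y : E ≃ₗᵢ[ℂ] L2 μ) (U : UnitaryRep G K) (z : HTensor E (HTensor (L2 μ) K)) :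
    jumpB Y U ((jumpA Y U).symm z) =
      (prodEquiv Y).symm (transformationIsometry μ U (prodEquiv Y z)) := by
  simp [jumpA, jumpB, ← transformationIsometry_jumpIso]

-- Matrix elements of the jump and of the transformation

omit [Group G] [TopologicalSpace G] [IsTopologicalGroup G]
  [LocallyCompactSpace G] [T2Space G] [SecondCountableTopology G] [BorelSpace G] in
theorem inner_symm_prodEquiv (Y : E ≃ₗᵢ[ℂ] L2 μ) (ξ : E) (b : L2 μ) (q : K)
    (Ψ : Lp K 2 (μ.prod μ)) :
    inner ℂ (tmul₃ ξ b q) ((prodEquiv Y).symm Ψ) = inner ℂ (prodVec (Y ξ) b q) Ψ := by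
  rw [← prodEquiv_tmul₃, LinearIsometryEquiv.inner_map_eq_flip]

/-- Fubini with `g` outermost: for fixed `g` the integral over `h` is the matrix element of `L(g)†`,
and the rest of the integrand is the kernel `|g⟩⟨g|` with `U(g)†`. -/
theorem inner_jumpA [μ.IsMulLeftInvariant] (Y : E ≃ₗᵢ[ℂ] L2 μ) (U : UnitaryRep G K)
    (ξ : E) (b : L2 μ) (q : K) (a' b' : L2 μ) (q' : K) :
    Integrable (fun g => ketBra g g (Y ξ) a' * inner ℂ b (((leftReg μ g)†) b') *
        inner ℂ q (((U.op g)†) q')) μ ∧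
      inner ℂ (tmul₃ ξ b q) (jumpA Y U (tmul₃ a' b' q')) =
        ∫ g, ketBra g g (Y ξ) a' * inner ℂ b (((leftReg μ g)†) b') *
          inner ℂ q (((U.op g)†) q') ∂μ := by
  obtain ⟨hi, he⟩ := inner_prodVec_twistedComp U measurable_fst.inv
    (measurePreserving_prod_mul μ μ) (Y ξ) b a' b' q q'
  have hf : ∀ g, ∫ h, conj (Y ξ g * b h) * (a' g * b' (g * h)) * inner ℂ q (U.op g⁻¹ q') ∂μ =
      ketBra g g (Y ξ) a' * inner ℂ b (((leftReg μ g)†) b') * inner ℂ q (((U.op g)†) q') := fun g => by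
    rw [inner_leftReg_adjoint, U.adjoint_op, ketBra, ← integral_const_mul, ← integral_mul_const]
    refine integral_congr_ae (Eventually.of_forall fun h => ?_)
    simp only [map_mul]; ring
  constructor
  · exact hi.integral_prod_left.congr (Eventually.of_forall hf)
  · refine (inner_symm_prodEquiv Y ξ b q _).trans ?_
    change inner ℂ _ (jumpIso μ U (prodEquiv (.refl ℂ _) (tmul₃ a' b' q'))) = _
    rw [prodEquiv_tmul₃, jumpIso_apply]
    refine (he.trans (integral_prod _ hi)).trans ?_
    exact integral_congr_ae (Eventually.of_forall hf)

/-- Fubini in the opposite order: for fixed `h` the integral over the first variable is the matrix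
element of the right translation by `h`. The substitution `h = g⁻¹` then produces `|g⁻¹⟩⟨g|` and
`U(g)†`. -/
theorem inner_transformation [μ.IsMulRightInvariant] [μ.IsInvInvariant] (Y : E ≃ₗᵢ[ℂ] L2 μ)
    (U : UnitaryRep G K) (ξ : E) (a : L2 μ) (q : K) (ξ' : E) (b' : L2 μ) (q' : K) :
    Integrable (fun g => inner ℂ (Y ξ) (rightReg μ g⁻¹ (Y ξ')) * ketBra g⁻¹ g a b' *
        inner ℂ q (((U.op g)†) q')) μ ∧
      inner ℂ (tmul₃ ξ a q)
          ((prodEquiv Y).symm (transformationIsometry μ U (prodEquiv Y (tmul₃ ξ' b' q')))) =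
        ∫ g, inner ℂ (Y ξ) (rightReg μ g⁻¹ (Y ξ')) * ketBra g⁻¹ g a b' *
          inner ℂ q (((U.op g)†) q') ∂μ := by
  obtain ⟨hi, he⟩ := inner_prodVec_twistedComp U measurable_snd
    measurePreserving_mul_inv_snd (Y ξ) a (Y ξ') b' q q'
  set Φ : G → ℂ := fun h => ∫ k, conj (Y ξ k * a h) * (Y ξ' (k * h) * b' h⁻¹) *
    inner ℂ q (U.op h q') ∂μ with hΦ
  have hf : ∀ g, Φ g⁻¹ = inner ℂ (Y ξ) (rightReg μ g⁻¹ (Y ξ')) * ketBra g⁻¹ g a b' *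
      inner ℂ q (((U.op g)†) q') := fun g => by
    rw [inner_rightReg, U.adjoint_op, ketBra, ← integral_mul_const, ← integral_mul_const]
    refine integral_congr_ae (Eventually.of_forall fun k => ?_)
    simp only [map_mul, inv_inv]; ring
  constructor
  · have h : Integrable Φ μ := hi.integral_prod_right
    exact h.comp_inv.congr (Eventually.of_forall hf)
  · rw [inner_symm_prodEquiv, prodEquiv_tmul₃]
    refine (he.trans (integral_prod_symm _ hi)).trans ?_
    rw [← integral_congr_ae (Eventually.of_forall hf)]
    exact (integral_inv_eq_self Φ μ).symm

end Jumps

/-! ### The jumps and the transformation of regular frames -/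

section Main

variable {G : Type*} [Group G] [TopologicalSpace G] [IsTopologicalGroup G]
  [LocallyCompactSpace G] [T2Space G] [SecondCountableTopology G] [MeasurableSpace G]
  [BorelSpace G] {μ : Measure G} [SigmaFinite μ] [μ.IsMulLeftInvariant] [μ.IsMulRightInvariant]
  {Λ : Type*} [MeasurableSpace Λ] {ν : Measure Λ}
  {H : Λ → Type*} [∀ r, NormedAddCommGroup (H r)] [∀ r, InnerProductSpace ℂ (H r)]
  [∀ r, CompleteSpace (H r)] {D : IrrepField G H}
  {HQ : Type*} [NormedAddCommGroup HQ] [InnerProductSpace ℂ HQ] [CompleteSpace HQ]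

omit [IsTopologicalGroup G] [LocallyCompactSpace G] [T2Space G] [SecondCountableTopology G]
  [MeasurableSpace G] [BorelSpace G] in
theorem IrrepField.rightOpAdj_eq (D : IrrepField G H) (ν : Measure Λ) (g : G) :
    D.rightOpAdj ν g = D.rightOp ν g⁻¹ := by
  simp only [IrrepField.rightOpAdj, IrrepField.rightOp, UnitaryRep.adjoint_op]

-- The intertwining of the right translations is what removes the Peter–Weyl map from the
-- transformation kernel.
omit [SigmaFinite μ] in
theorem PeterWeylIso.inner_rightOpAdj (W : PeterWeylIso μ D ν) (g : G) (ξ ξ' : D.Space ν) :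
    inner ℂ ξ (D.rightOpAdj ν g ξ') =
      inner ℂ (W.X.symm ξ) (rightReg μ g⁻¹ (W.X.symm ξ')) := by
  rw [D.rightOpAdj_eq, ← W.X.inner_map_map, W.map_right, W.X.apply_symm_apply,
    W.X.apply_symm_apply]

theorem isJumpA_jumpA (W : PeterWeylIso μ D ν) (UQ : UnitaryRep G HQ) :
    IsJumpA W UQ (jumpA W.X.symm UQ : _ →L[ℂ] _) := by
  rintro ⟨ξ, b, q⟩ ⟨a', b', q'⟩
  exact inner_jumpA W.X.symm UQ ξ b q a' b' q'

theorem isJumpB_jumpB (W : PeterWeylIso μ D ν) (UQ : UnitaryRep G HQ) :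
    IsJumpB W UQ (jumpB W.X.symm UQ : _ →L[ℂ] _) := by
  rintro ⟨ξ, a, q⟩ ⟨a', b', q'⟩
  -- Exchanging `a'` and `b'` turns the kernel of the jump to `A` into that of the jump to `B`, up
  -- to the order of the factors.
  obtain ⟨hi, he⟩ := inner_jumpA W.X.symm UQ ξ a q b' a' q'
  have hc : ∀ g, ketBra g g (W.X.symm ξ) b' * inner ℂ a (((leftReg μ g)†) a') *
      inner ℂ q (((UQ.op g)†) q') = inner ℂ a (((leftReg μ g)†) a') *
      ketBra g g (W.X.symm ξ) b' * inner ℂ q (((UQ.op g)†) q') := fun g => by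
    rw [mul_comm (ketBra _ _ _ _)]
  rw [← jumpB_tmul₃] at he
  simp only [hc] at hi he
  exact ⟨hi, he⟩

theorem isTransformationFormula_jumpB_jumpA [μ.IsInvInvariant] (W : PeterWeylIso μ D ν)
    (UQ : UnitaryRep G HQ) :
    IsTransformationFormula μ D ν UQ
      ((jumpB W.X.symm UQ : HTensor (L2 μ) (HTensor (L2 μ) HQ) →L[ℂ] _) ∘L
        ((jumpA W.X.symm UQ).symm : HTensor (D.Space ν) (HTensor (L2 μ) HQ) →L[ℂ] _)) := by
  rintro ⟨ξ, a, q⟩ ⟨ξ', b', q'⟩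
  obtain ⟨hi, he⟩ := inner_transformation W.X.symm UQ ξ a q ξ' b' q'
  rw [← jumpB_jumpA_symm] at he
  simp only [← W.inner_rightOpAdj] at hi he
  exact ⟨hi, he⟩

end Main

end QRF

end

-- Unitary jumps, their transformation, and its independence of the Peter–Weyl isomorphism

theorem mainTheorem6
    {G : Type*} [Group G] [TopologicalSpace G] [IsTopologicalGroup G] [LocallyCompactSpace G]
    [T2Space G] [SecondCountableTopology G] [MeasurableSpace G] [BorelSpace G]
    (μ : MeasureTheory.Measure G) [μ.IsHaarMeasure] [μ.IsMulRightInvariant] [μ.IsInvInvariant]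
    {Λ : Type*} [MeasurableSpace Λ] (ν : MeasureTheory.Measure Λ) [MeasureTheory.SigmaFinite ν]
    {H : Λ → Type*} [∀ r, NormedAddCommGroup (H r)] [∀ r, InnerProductSpace ℂ (H r)]
    [∀ r, CompleteSpace (H r)] (D : QRF.IrrepField G H)
    {HQ : Type*} [NormedAddCommGroup HQ] [InnerProductSpace ℂ HQ] [CompleteSpace HQ]
    (UQ : QRF.UnitaryRep G HQ) :
    (∀ W : QRF.PeterWeylIso μ D ν,
      (∃! VA, QRF.IsJumpA W UQ VA) ∧
      (∃! VB, QRF.IsJumpB W UQ VB) ∧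
      (∃! T, QRF.IsTransformationFormula μ D ν UQ T) ∧
      ∀ VA VB, QRF.IsJumpA W UQ VA → QRF.IsJumpB W UQ VB →
        (VA† ∘L VA = .id ℂ _ ∧ VA ∘L VA† = .id ℂ _) ∧
        (VB† ∘L VB = .id ℂ _ ∧ VB ∘L VB† = .id ℂ _) ∧
        (∀ a b q, VB (QRF.tmul₃ a b q) = VA (QRF.tmul₃ b a q)) ∧
        QRF.IsTransformationFormula μ D ν UQ (VB ∘L VA†)) ∧
    (∀ W W' : QRF.PeterWeylIso μ D ν, ∀ VA VB VA' VB',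
      QRF.IsJumpA W UQ VA → QRF.IsJumpB W UQ VB →
      QRF.IsJumpA W' UQ VA' → QRF.IsJumpB W' UQ VB' →
      VB ∘L VA† = VB' ∘L VA'†) := by
  -- By uniqueness, every operator given by the weak integral is the explicit unitary, so its
  -- properties can be read off there.
  have hA : ∀ (W : QRF.PeterWeylIso μ D ν) VA, QRF.IsJumpA W UQ VA →
      VA = (QRF.jumpA W.X.symm UQ : _ →L[ℂ] _) :=
    fun W _ h => h.unique (QRF.isJumpA_jumpA W UQ)
  have hB : ∀ (W : QRF.PeterWeylIso μ D ν) VB, QRF.IsJumpB W UQ VB →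
      VB = (QRF.jumpB W.X.symm UQ : _ →L[ℂ] _) :=
    fun W _ h => h.unique (QRF.isJumpB_jumpB W UQ)
  have hT : ∀ (W : QRF.PeterWeylIso μ D ν) VA VB, QRF.IsJumpA W UQ VA → QRF.IsJumpB W UQ VB →
      QRF.IsTransformationFormula μ D ν UQ (VB ∘L VA†) := fun W VA VB hVA hVB => by
    rw [hA W VA hVA, hB W VB hVB, LinearIsometryEquiv.adjoint_eq_symm]
    exact QRF.isTransformationFormula_jumpB_jumpA W UQ
  refine ⟨fun W => ⟨⟨_, QRF.isJumpA_jumpA W UQ, hA W⟩, ⟨_, QRF.isJumpB_jumpB W UQ, hB W⟩,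
    ⟨_, QRF.isTransformationFormula_jumpB_jumpA W UQ,
      fun _ h => h.unique (QRF.isTransformationFormula_jumpB_jumpA W UQ)⟩,
    fun VA VB hVA hVB => ⟨?_, ?_, fun a b q => ?_, hT W VA VB hVA hVB⟩⟩,
    -- Both products satisfy one and the same weak formula, in which neither `W` nor `W'` occurs.
    fun W W' VA VB VA' VB' hVA hVB hVA' hVB' =>
      (hT W VA VB hVA hVB).unique (hT W' VA' VB' hVA' hVB')⟩
  · rw [hA W VA hVA, LinearIsometryEquiv.adjoint_eq_symm]
    constructor <;> ext z <;> simp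
  · rw [hB W VB hVB, LinearIsometryEquiv.adjoint_eq_symm]
    constructor <;> ext z <;> simp
  · rw [hA W VA hVA, hB W VB hVB]
    exact QRF.jumpB_tmul₃ W.X.symm UQ a b q
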